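/- Let $H$ be a complex Hilbert space and let $A$ be a closed, densely defined, non-negative Hermitian operator in $H$ with finite defect numbers, i.e. $\dim N_{i}<\infty$ and $\dim N_{-i}<\infty$, where $N_z=\ker(A^*-zE)$ and $E$ is the identity operator. Let $T=-E+2(E+A)^{-1}$, with $D(T)=(A+E)D(A)$. Let $T_\mu$ and $T_M$ be the least and the greatest (in the order of quadratic forms) among the self-adjoint operators $\widetilde T$ on $H$ with $\widetilde T\supseteq T$ and $\|\widetilde T\|\le 1$. Let $$A_\mu=-E+2(E+T_\mu)^{-1},\qquad A_M=-E+2(E+T_M)^{-1}$$ be the corresponding Friedrichs and Krein extensions of $A$. Assume that $A$ is in the completely indeterminate case, i.e. $\ker\left((T_M-T_\mu)|_{N_{-1}}\right)=\{0\}$. Then $A_\mu$ and $A_M$ are transversal extensions of $A$. That is, both are proper extensions of $A$ (operators $\widehat A$ with $A\subseteq\widehat A\subseteq A^*$ and $(\widehat A^*)^*=\widehat A$), and $$D(A_\mu)\cap D(A_M)=D(A),\qquad D(A_\mu)+D(A_M)=D(A^*).$$ -/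

import Mathlib

namespace NonnegExtension

variable {H : Type*} [NormedAddCommGroup H] [InnerProductSpace ℂ H] [CompleteSpace H]

/-- The transformation `A ↦ -E + 2 (E + A)⁻¹`, with domain `(A + E) D(A)`. It is an involution that
exchanges non-negative operators and contractions. (It is applied only to operators `A` for which
`E + A` is injective; `LinearPMap.inverse` is then the genuine inverse on the range.) -/
noncomputable def cayley (A : H →ₗ.[ℂ] H) : H →ₗ.[ℂ] H :=
  (-LinearMap.id : H →ₗ[ℂ] H) +ᵥ
    ((2 : ℂ) • ((LinearMap.id : H →ₗ[ℂ] H) +ᵥ A).inverse)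

/-- An everywhere defined bounded operator, seen as a partially defined operator. -/
def everywhere (S : H →L[ℂ] H) : H →ₗ.[ℂ] H := (S : H →ₗ[ℂ] H).toPMap ⊤

/-- The self-adjoint contractive extensions `S ⊇ T` in `H` of a partially defined operator `T`. -/
def contractiveExtensions (T : H →ₗ.[ℂ] H) : Set (H →L[ℂ] H) :=
  {S | IsSelfAdjoint S ∧ ‖S‖ ≤ 1 ∧ T ≤ everywhere S}

/-- `T_μ`: the least self-adjoint contractive extension (for the order of quadratic forms) of
`T = -E + 2 (E + A)⁻¹`. -/
noncomputable def Tμ (A : H →ₗ.[ℂ] H) : H →L[ℂ] H :=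
  Classical.epsilon fun S => IsLeast (contractiveExtensions (cayley A)) S

/-- `T_M`: the greatest self-adjoint contractive extension (for the order of quadratic forms) of
`T = -E + 2 (E + A)⁻¹`. -/
noncomputable def TM (A : H →ₗ.[ℂ] H) : H →L[ℂ] H :=
  Classical.epsilon fun S => IsGreatest (contractiveExtensions (cayley A)) S

/-- The Friedrichs extension `A_μ = -E + 2 (E + T_μ)⁻¹`. -/
noncomputable def Aμ (A : H →ₗ.[ℂ] H) : H →ₗ.[ℂ] H := cayley (everywhere (Tμ A))

/-- The Krein extension `A_M = -E + 2 (E + T_M)⁻¹`. -/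
noncomputable def AM (A : H →ₗ.[ℂ] H) : H →ₗ.[ℂ] H := cayley (everywhere (TM A))

/-- The defect subspace `N_z = ker (A* - z E)`: all `x ∈ D(A*)` with `A* x = z x`. -/
noncomputable def defectSubspace (A : H →ₗ.[ℂ] H) (z : ℂ) : Submodule ℂ H :=
  A.adjoint.graph.comap (LinearMap.id.prod (z • LinearMap.id))

/-- The defect numbers `dim N_i` and `dim N_{-i}` are finite. -/
def FiniteDefectNumbers (A : H →ₗ.[ℂ] H) : Prop :=
  FiniteDimensional ℂ (defectSubspace A Complex.I) ∧
    FiniteDimensional ℂ (defectSubspace A (-Complex.I))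

/-- The completely indeterminate case: `Υ = ker (C|_{N_{-1}}) = {0}`, where `C = T_M - T_μ`. -/
def CompletelyIndeterminate (A : H →ₗ.[ℂ] H) : Prop :=
  LinearMap.ker (((TM A - Tμ A : H →L[ℂ] H) : H →ₗ[ℂ] H).domRestrict (defectSubspace A (-1))) = ⊥

/-- `B` is a proper extension of `A`: `A ⊆ B ⊆ A*` and `(B*)* = B`. -/
def IsProperExtension (A B : H →ₗ.[ℂ] H) : Prop :=
  A ≤ B ∧ B ≤ A.adjoint ∧ B.adjoint.adjoint = B

/-- `B₁` and `B₂` are transversal extensions of `A`: they are proper extensions,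
`D(B₁) ∩ D(B₂) = D(A)` (they are disjoint) and `D(B₁) + D(B₂) = D(A*)`. -/
def Transversal (A B₁ B₂ : H →ₗ.[ℂ] H) : Prop :=
  IsProperExtension A B₁ ∧ IsProperExtension A B₂ ∧
    B₁.domain ⊓ B₂.domain = A.domain ∧ B₁.domain ⊔ B₂.domain = A.adjoint.domain

end NonnegExtension

/-!
Write `T = -E + 2 (E + A)⁻¹`, so that `T (a + A a) = a - A a`. Everything happens on the side of the
self-adjoint contractions `S ⊇ T`: such an `S` corresponds to the self-adjoint extension `Ã` of `A`
whose graph is `{(y + S y, y - S y)}`.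

*Existence of the extreme extensions.* A self-adjoint contraction `S` extends `T` exactly when the
positive operator `E + S` takes the value `2 a` at `a + A a`, and also exactly when `E - S` takes the
value `2 A a` there. Both are instances of `exists_least_positive_extension`: complete the space on
which values `B₀ v` at the points `j v` are prescribed with respect to the form `⟪B₀ v, j w⟫`; then
`B₀` extends to a bounded operator `J` on the completion, and `J J*` is the least positive operator
with these values. Its range meets the orthogonal complement of the range of `j` only in `0`, since
`⟪J J* u, j v⟫ = ⟪J* u, [v]⟫`. For `T_μ` this says `(E + T_μ) H ∩ N_{-1} = {0}`, because `N_{-1}` is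
the orthogonal complement of `(E + A) D(A)`.

*Transversality.* The operator `C = T_M - T_μ` is self-adjoint and vanishes on `(E + A) D(A)`, so it
maps `H` into `N_{-1}`; by assumption it is injective on `N_{-1}`.
If `(E + T_μ) y = (E + T_M) z`, then `(E + T_μ) (y - z) = C z` lies in `N_{-1}`, hence is `0`. So `z`
has no component in `N_{-1}` and lies in the closed subspace `(E + A) D(A)`, and
`(E + T_M) z = (E + T) z` lies in `D(A)`.
For the sum, `D(A*) = D(A_μ) + N_{-1}`. Since `N_{-1}` embeds into `N_i`, it is finite-dimensional, so
`C` maps it onto itself, and `N_{-1} = C N_{-1}` is contained in `(E + T_M) H + (E + T_μ) H`.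
-/

open scoped InnerProductSpace

namespace NonnegExtension

variable {H : Type*} [NormedAddCommGroup H] [InnerProductSpace ℂ H]

/-! ### Positive operators and the transformation of operators -/

/-- The Cauchy–Schwarz inequality for the semi-inner product `⟪B x, y⟫` of a positive operator. -/
theorem norm_inner_sq_le_of_isPositive {B : H →L[ℂ] H} (hB : B.IsPositive) (x y : H) :
    ‖⟪B x, y⟫_ℂ‖ ^ 2 ≤ (⟪B x, x⟫_ℂ).re * (⟪B y, y⟫_ℂ).re := by
  let c : PreInnerProductSpace.Core ℂ H :=
    { inner := fun x y => ⟪B x, y⟫_ℂ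
      conj_inner_symm := fun x y => by
        rw [inner_conj_symm, hB.inner_left_eq_inner_right]
      re_inner_nonneg := fun x => hB.re_inner_nonneg_left x
      add_left := fun x y z => by rw [map_add, inner_add_left]
      smul_left := fun x y r => by rw [map_smul, inner_smul_left] }
  have h := @InnerProductSpace.Core.inner_mul_inner_self_le ℂ H _ _ _ c x y
  change ‖⟪B x, y⟫_ℂ‖ * ‖⟪B y, x⟫_ℂ‖ ≤ (⟪B x, x⟫_ℂ).re * (⟪B y, y⟫_ℂ).re at h
  rwa [hB.inner_left_eq_inner_right y x, norm_inner_symm y (B x), ← sq] at h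

/-- The graph of `-E + 2 (E + P)⁻¹`. Injectivity of `E + P` makes `LinearPMap.inverse` genuine. -/
theorem mem_graph_cayley_iff {P : H →ₗ.[ℂ] H} (hP : ∀ a : P.domain, (a : H) + P a = 0 → a = 0)
    {p q : H} :
    (p, q) ∈ (cayley P).graph ↔ ∃ a : P.domain, p = a + P a ∧ q = a - P a := by
  let Q : H →ₗ.[ℂ] H := (LinearMap.id : H →ₗ[ℂ] H) +ᵥ P
  have hQ : Q.toFun.ker = ⊥ := (LinearMap.ker_eq_bot').2 hP
  have hgraph : ∀ r s : H, (r, s) ∈ Q.inverse.graph ↔ ∃ a : P.domain, r = a + P a ∧ s = a := by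
    intro r s
    rw [LinearPMap.inverse_graph hQ]
    constructor
    · rintro ⟨⟨x, y⟩, hxy, h⟩
      obtain ⟨a, rfl, rfl⟩ := (LinearPMap.mem_graph_iff _).1 hxy
      simp only [LinearEquiv.coe_coe, LinearEquiv.prodComm_apply, Prod.swap_prod_mk,
        Prod.mk.injEq] at h
      exact ⟨a, h.1.symm, h.2.symm⟩
    · rintro ⟨a, rfl, rfl⟩
      exact ⟨(a, a + P a), (LinearPMap.mem_graph_iff _).2 ⟨a, rfl, rfl⟩, rfl⟩
  have hval : ∀ x : (cayley P).domain, cayley P x = -(x : H) + (2 : ℂ) • Q.inverse x :=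
    fun x => rfl
  constructor
  · intro h
    obtain ⟨x, hx, hx'⟩ := (LinearPMap.mem_graph_iff _).1 h
    obtain ⟨a, ha, ha'⟩ := (hgraph x (Q.inverse x)).1 (LinearPMap.mem_graph Q.inverse x)
    refine ⟨a, hx.symm.trans ha, ?_⟩
    simp only at hx'
    rw [← hx', hval, ha', ha]
    module
  · rintro ⟨a, rfl, rfl⟩
    have h := (hgraph (a + P a) a).2 ⟨a, rfl, rfl⟩
    obtain ⟨x, hx, hx'⟩ := (LinearPMap.mem_graph_iff _).1 h
    refine (LinearPMap.mem_graph_iff _).2 ⟨x, hx, ?_⟩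
    refine (hval x).trans ?_
    rw [hx', hx]
    module

theorem mem_graph_everywhere_iff {S : H →L[ℂ] H} {p q : H} :
    (p, q) ∈ (everywhere S).graph ↔ q = S p := by
  simp [everywhere, LinearPMap.mem_graph_iff, eq_comm]

theorem norm_add_apply_sq {A : H →ₗ.[ℂ] H} (hsymm : A.IsFormalAdjoint A) (a : A.domain) :
    ‖(a : H) + A a‖ ^ 2 = ‖(a : H)‖ ^ 2 + 2 * (⟪A a, a⟫_ℂ).re + ‖A a‖ ^ 2 := by
  rw [@norm_add_sq ℂ, ← hsymm a a]
  rfl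

theorem eq_zero_of_add_apply_eq_zero {A : H →ₗ.[ℂ] H} (hsymm : A.IsFormalAdjoint A)
    (hnonneg : ∀ x : A.domain, 0 ≤ (⟪A x, x⟫_ℂ).re) (a : A.domain) (h : (a : H) + A a = 0) :
    a = 0 := by
  have h1 := norm_add_apply_sq hsymm a
  have h2 := hnonneg a
  rw [h, norm_zero] at h1
  have : ‖(a : H)‖ = 0 := by nlinarith [sq_nonneg ‖A a‖, sq_nonneg ‖(a : H)‖]
  exact Subtype.ext (norm_eq_zero.1 this)

/-- The map `E + A` on the domain of `A`. -/
def idAdd (A : H →ₗ.[ℂ] H) : A.domain →ₗ[ℂ] H := A.domain.subtype + A.toFun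

theorem idAdd_apply {A : H →ₗ.[ℂ] H} (a : A.domain) : idAdd A a = a + A a := rfl

/-- `‖B x‖² ≤ 2 ⟪B x, x⟫` is `‖(B - E) x‖² ≤ ‖x‖²` expanded. -/
theorem norm_sub_one_le_one {B : H →L[ℂ] H} (hB : ∀ x, ‖B x‖ ^ 2 ≤ 2 * (⟪B x, x⟫_ℂ).re) :
    ‖B - 1‖ ≤ 1 := by
  refine ContinuousLinearMap.opNorm_le_bound _ zero_le_one fun x => ?_
  refine abs_le_of_sq_le_sq' ?_ (by positivity) |>.2
  have h : ‖B x - x‖ ^ 2 = ‖B x‖ ^ 2 - 2 * (⟪B x, x⟫_ℂ).re + ‖x‖ ^ 2 := @norm_sub_sq ℂ _ _ _ _ _ _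
  rw [one_mul]
  change ‖B x - x‖ ^ 2 ≤ _
  linarith [hB x]

variable [CompleteSpace H]

/-! ### The least positive bounded extension -/

/-- The construction behind `exists_least_positive_extension`, for a space `V` that already carries
the semi-inner product `⟪B₀ v, j w⟫`. If `J` extends `B₀` to the completion of `V`, then
`J* (j v)` is the class of `v`, and the extension sought is `J J*`. -/
theorem exists_least_positive_extension_of_inner {V : Type*} [SeminormedAddCommGroup V]
    [InnerProductSpace ℂ V] (j B₀ : V →ₗ[ℂ] H) (hinner : ∀ v w, ⟪v, w⟫_ℂ = ⟪B₀ v, j w⟫_ℂ)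
    (hbound : ∀ v, ‖B₀ v‖ ^ 2 ≤ 2 * ‖v‖ ^ 2) :
    ∃ B : H →L[ℂ] H, B.IsPositive ∧ (∀ v, B (j v) = B₀ v) ∧
      (∀ x, ‖B x‖ ^ 2 ≤ 2 * (⟪B x, x⟫_ℂ).re) ∧
      (∀ B' : H →L[ℂ] H, B'.IsPositive → (∀ v, B' (j v) = B₀ v) → B ≤ B') ∧
      ∀ u, (∀ v, ⟪B u, j v⟫_ℂ = 0) → B u = 0 := by
  have hb : ∀ v, ‖B₀ v‖ ≤ √2 * ‖v‖ := fun v => by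
    refine abs_le_of_sq_le_sq' ?_ (by positivity) |>.2
    rw [mul_pow, Real.sq_sqrt (by norm_num)]
    exact hbound v
  let e : V →L[ℂ] UniformSpace.Completion V := UniformSpace.Completion.toComplL
  have he : ∀ v, e v = (v : UniformSpace.Completion V) := fun v => rfl
  have hd : DenseRange e := UniformSpace.Completion.denseRange_coe
  have hu : IsUniformInducing e := UniformSpace.Completion.isUniformInducing_coe V
  let J : UniformSpace.Completion V →L[ℂ] H := (B₀.mkContinuous (√2) hb).extend e
  have hJ : ∀ v, J (e v) = B₀ v := fun v =>
    ContinuousLinearMap.extend_eq (B₀.mkContinuous (√2) hb) hd hu v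
  have hJn : ∀ w, ‖J w‖ ≤ √2 * ‖w‖ := fun w => by
    refine hd.induction_on (p := fun w => ‖J w‖ ≤ √2 * ‖w‖) w
      (isClosed_le (by fun_prop) (by fun_prop)) fun v => ?_
    rw [hJ, he, UniformSpace.Completion.norm_coe]
    exact hb v
  let K := ContinuousLinearMap.adjoint J
  have hK : ∀ v, K (j v) = e v := fun v => by
    refine ext_inner_left ℂ fun w => ?_
    refine hd.induction_on (p := fun w => ⟪w, K (j v)⟫_ℂ = ⟪w, e v⟫_ℂ) w
      (isClosed_eq (by fun_prop) (by fun_prop)) fun w => ?_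
    rw [ContinuousLinearMap.adjoint_inner_right, hJ, he, he, UniformSpace.Completion.inner_coe,
      hinner]
  have hKK : ∀ x y, ⟪J (K x), y⟫_ℂ = ⟪K x, K y⟫_ℂ := fun x y =>
    (ContinuousLinearMap.adjoint_inner_right J _ _).symm
  have hKx : ∀ x, (⟪J (K x), x⟫_ℂ).re = ‖K x‖ ^ 2 := fun x => by
    rw [hKK]; exact inner_self_eq_norm_sq (𝕜 := ℂ) _
  refine ⟨J ∘L K, ContinuousLinearMap.isPositive_self_comp_adjoint J, fun v => ?_, fun x => ?_,
    fun B' hB' hB'j => ?_, fun u hu => ?_⟩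
  · simp [hK, hJ]
  · rw [ContinuousLinearMap.comp_apply, hKx]
    calc ‖J (K x)‖ ^ 2 ≤ (√2 * ‖K x‖) ^ 2 := by gcongr; exact hJn _
      _ = 2 * ‖K x‖ ^ 2 := by rw [mul_pow, Real.sq_sqrt (by norm_num)]
  · have hJK := ContinuousLinearMap.isPositive_self_comp_adjoint J
    refine (ContinuousLinearMap.le_def _ _).2 ((ContinuousLinearMap.isPositive_def).2
      ⟨hB'.isSymmetric.sub hJK.isSymmetric, fun y => ?_⟩)
    -- `‖K y‖² = sup |⟪K y, e v⟫|² / ‖v‖² = sup |⟪B' y, j v⟫|² / ⟪B' (j v), j v⟫ ≤ ⟪B' y, y⟫`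
    have key : ∀ w, ‖⟪K y, w⟫_ℂ‖ ^ 2 ≤ (⟪B' y, y⟫_ℂ).re * ‖w‖ ^ 2 := fun w => by
      refine hd.induction_on (p := fun w => ‖⟪K y, w⟫_ℂ‖ ^ 2 ≤ (⟪B' y, y⟫_ℂ).re * ‖w‖ ^ 2) w
        (isClosed_le (by fun_prop) (by fun_prop)) fun v => ?_
      have h := norm_inner_sq_le_of_isPositive hB' y (j v)
      rw [hB'.inner_left_eq_inner_right y, hB'j, ← hinner] at h
      rw [ContinuousLinearMap.adjoint_inner_left, hJ, he, UniformSpace.Completion.norm_coe]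
      refine h.trans_eq ?_
      congr 1
      exact inner_self_eq_norm_sq (𝕜 := ℂ) v
    have h0 : 0 ≤ (⟪B' y, y⟫_ℂ).re := hB'.re_inner_nonneg_left y
    have h1 := key (K y)
    rw [inner_self_eq_norm_sq_to_K, norm_pow] at h1
    simp only [Complex.coe_algebraMap, Complex.norm_real, norm_norm] at h1
    have h2 : ‖K y‖ ^ 2 ≤ (⟪B' y, y⟫_ℂ).re := by
      rcases (sq_nonneg ‖K y‖).eq_or_lt with h | h
      · rwa [← h]
      · nlinarith
    have h3 := hKx y
    simp only [ContinuousLinearMap.reApplyInnerSelf_apply, sub_apply,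
      inner_sub_left, ContinuousLinearMap.comp_apply, map_sub, RCLike.re_to_complex] at h3 ⊢
    linarith
  · have h : K u = 0 := by
      refine ext_inner_right ℂ fun w => ?_
      refine hd.induction_on (p := fun w => ⟪K u, w⟫_ℂ = ⟪0, w⟫_ℂ) w
        (isClosed_eq (by fun_prop) (by fun_prop)) fun v => ?_
      rw [← hK, ← hKK, inner_zero_left]
      exact hu v
    simp [h]

/-- Let `B₀ v` be prescribed as the value at `j v`, symmetrically and with
`‖B₀ v‖² ≤ 2 ⟪B₀ v, j v⟫`. Among the positive bounded operators with `B (j v) = B₀ v` there is a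
least one; it satisfies `‖B x‖² ≤ 2 ⟪B x, x⟫`, that is `‖B - E‖ ≤ 1`, and its range meets the
orthogonal complement of the range of `j` only in `0`. -/
theorem exists_least_positive_extension {V : Type*} [AddCommGroup V] [Module ℂ V]
    (j B₀ : V →ₗ[ℂ] H) (hsymm : ∀ v w, ⟪B₀ v, j w⟫_ℂ = ⟪j v, B₀ w⟫_ℂ)
    (hbound : ∀ v, ‖B₀ v‖ ^ 2 ≤ 2 * (⟪B₀ v, j v⟫_ℂ).re) :
    ∃ B : H →L[ℂ] H, B.IsPositive ∧ (∀ v, B (j v) = B₀ v) ∧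
      (∀ x, ‖B x‖ ^ 2 ≤ 2 * (⟪B x, x⟫_ℂ).re) ∧
      (∀ B' : H →L[ℂ] H, B'.IsPositive → (∀ v, B' (j v) = B₀ v) → B ≤ B') ∧
      ∀ u, (∀ v, ⟪B u, j v⟫_ℂ = 0) → B u = 0 := by
  let c : PreInnerProductSpace.Core ℂ V :=
    { inner := fun v w => ⟪B₀ v, j w⟫_ℂ
      conj_inner_symm := fun v w => by rw [inner_conj_symm, hsymm]
      re_inner_nonneg := fun v => by
        have := hbound v
        have := sq_nonneg ‖B₀ v‖
        change 0 ≤ (⟪B₀ v, j v⟫_ℂ).re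
        linarith
      add_left := fun x y z => by rw [map_add, inner_add_left]
      smul_left := fun x y r => by rw [map_smul, inner_smul_left] }
  let : SeminormedAddCommGroup V := InnerProductSpace.Core.toSeminormedAddCommGroup (c := c)
  let : InnerProductSpace ℂ V := InnerProductSpace.ofCore c
  refine exists_least_positive_extension_of_inner (V := V) j B₀ (fun v w => rfl) fun v => ?_
  rw [← inner_self_eq_norm_sq (𝕜 := ℂ) v]
  exact hbound v

/-! ### Contractive extensions -/

section Nonneg

variable {A : H →ₗ.[ℂ] H}

theorem mem_contractiveExtensions_cayley_iff (hsymm : A.IsFormalAdjoint A)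
    (hnonneg : ∀ x : A.domain, 0 ≤ (⟪A x, x⟫_ℂ).re) {S : H →L[ℂ] H} :
    S ∈ contractiveExtensions (cayley A) ↔
      IsSelfAdjoint S ∧ ‖S‖ ≤ 1 ∧ ∀ a : A.domain, S (a + A a) = a - A a := by
  refine and_congr_right fun _ => and_congr_right fun _ => ?_
  rw [← LinearPMap.le_graph_iff]
  constructor
  · intro h a
    exact (mem_graph_everywhere_iff.1 (h ((mem_graph_cayley_iff
      (eq_zero_of_add_apply_eq_zero hsymm hnonneg)).2 ⟨a, rfl, rfl⟩))).symm
  · rintro h ⟨p, q⟩ hpq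
    obtain ⟨a, rfl, rfl⟩ := (mem_graph_cayley_iff
      (eq_zero_of_add_apply_eq_zero hsymm hnonneg)).1 hpq
    exact mem_graph_everywhere_iff.2 (h a).symm

theorem isPositive_one_add {S : H →L[ℂ] H} (hS : IsSelfAdjoint S) (hn : ‖S‖ ≤ 1) :
    (1 + S).IsPositive := by
  refine ContinuousLinearMap.isPositive_def'.2 ⟨(IsSelfAdjoint.one _).add hS, fun x => ?_⟩
  have h1 : ‖⟪S x, x⟫_ℂ‖ ≤ ‖x‖ * ‖x‖ := (norm_inner_le_norm _ _).trans
    (mul_le_mul_of_nonneg_right ((S.le_of_opNorm_le hn x).trans_eq (one_mul _)) (norm_nonneg _))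
  have h2 := (abs_le.1 ((Complex.abs_re_le_norm _).trans h1)).1
  have h3 : (⟪x, x⟫_ℂ).re = ‖x‖ * ‖x‖ := inner_self_eq_norm_mul_norm (𝕜 := ℂ) x
  simp only [ContinuousLinearMap.reApplyInnerSelf_apply, add_apply,
    inner_add_left, map_add, RCLike.re_to_complex, one_apply_eq_self]
  linarith

/-- The least extension is `B - E`, where `B` is the least positive operator that takes the value
`2 a` at `a + A a`. -/
theorem exists_isLeast_contractiveExtensions (hsymm : A.IsFormalAdjoint A)
    (hnonneg : ∀ x : A.domain, 0 ≤ (⟪A x, x⟫_ℂ).re) :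
    ∃ S, IsLeast (contractiveExtensions (cayley A)) S ∧
      ∀ u, (∀ a : A.domain, ⟪u + S u, a + A a⟫_ℂ = 0) → u + S u = 0 := by
  obtain ⟨B, hB, hBj, hB2, hmin, hdisj⟩ := exists_least_positive_extension (idAdd A)
    ((2 : ℂ) • A.domain.subtype)
    (fun v w => by
      simp only [idAdd_apply, LinearMap.smul_apply, Submodule.subtype_apply, inner_smul_left,
        inner_smul_right, inner_add_left, inner_add_right, hsymm v w,
        map_ofNat, mul_add])
    (fun v => by
      have h1 : ‖(2 : ℂ) • (v : H)‖ ^ 2 = 4 * ‖(v : H)‖ ^ 2 := by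
        rw [norm_smul, mul_pow]; norm_num
      have h2 : (⟪(2 : ℂ) • (v : H), v + A v⟫_ℂ).re = 2 * ‖(v : H)‖ ^ 2 + 2 * (⟪A v, v⟫_ℂ).re := by
        rw [inner_smul_left, inner_add_right, hsymm v v, inner_self_eq_norm_sq_to_K]
        simp [← Complex.ofReal_pow, mul_add]
      change ‖(2 : ℂ) • (v : H)‖ ^ 2 ≤ 2 * (⟪(2 : ℂ) • (v : H), v + A v⟫_ℂ).re
      linarith [hnonneg v, sq_nonneg ‖(v : H)‖])
  have hBj' : ∀ a : A.domain, B (a + A a) = (2 : ℂ) • (a : H) := hBj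
  have happ : ∀ x, (B - 1) x = B x - x := fun x => rfl
  have happ' : ∀ x, x + (B - 1) x = B x := fun x => by rw [happ]; abel
  refine ⟨B - 1, ⟨(mem_contractiveExtensions_cayley_iff hsymm hnonneg).2
    ⟨hB.isSelfAdjoint.sub (IsSelfAdjoint.one _), norm_sub_one_le_one hB2, fun a => ?_⟩,
    fun S hS => ?_⟩, fun u hu => ?_⟩
  · rw [happ, hBj']
    module
  · obtain ⟨hSs, hSn, hSA⟩ := (mem_contractiveExtensions_cayley_iff hsymm hnonneg).1 hS
    have h := hmin (1 + S) (isPositive_one_add hSs hSn) fun a => by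
      change (a + A a) + S (a + A a) = (2 : ℂ) • (a : H)
      rw [hSA]
      module
    rw [ContinuousLinearMap.le_def] at h ⊢
    convert h using 1
    abel
  · rw [happ']
    exact hdisj u fun a => by rw [← happ']; exact hu a

/-- The greatest extension is `E - B`, where `B` is the least positive operator that takes the value
`2 A a` at `a + A a`. -/
theorem exists_isGreatest_contractiveExtensions (hsymm : A.IsFormalAdjoint A)
    (hnonneg : ∀ x : A.domain, 0 ≤ (⟪A x, x⟫_ℂ).re) :
    ∃ S, IsGreatest (contractiveExtensions (cayley A)) S := by
  obtain ⟨B, hB, hBj, hB2, hmin, -⟩ := exists_least_positive_extension (idAdd A)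
    ((2 : ℂ) • A.toFun)
    (fun v w => by
      change ⟪(2 : ℂ) • A v, w + A w⟫_ℂ = ⟪v + A v, (2 : ℂ) • A w⟫_ℂ
      simp only [inner_smul_left, inner_smul_right, inner_add_left, inner_add_right, hsymm v w,
        map_ofNat, mul_add])
    (fun v => by
      have h1 : ‖(2 : ℂ) • A v‖ ^ 2 = 4 * ‖A v‖ ^ 2 := by
        rw [norm_smul, mul_pow]; norm_num
      have h2 : (⟪(2 : ℂ) • A v, v + A v⟫_ℂ).re = 2 * (⟪A v, v⟫_ℂ).re + 2 * ‖A v‖ ^ 2 := by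
        rw [inner_smul_left, inner_add_right, inner_self_eq_norm_sq_to_K]
        simp [← Complex.ofReal_pow, mul_add]
      change ‖(2 : ℂ) • A v‖ ^ 2 ≤ 2 * (⟪(2 : ℂ) • A v, v + A v⟫_ℂ).re
      linarith [hnonneg v, sq_nonneg ‖A v‖])
  have hBj' : ∀ a : A.domain, B (a + A a) = (2 : ℂ) • A a := hBj
  have happ : ∀ x, (1 - B) x = x - B x := fun x => rfl
  refine ⟨1 - B, (mem_contractiveExtensions_cayley_iff hsymm hnonneg).2
    ⟨(IsSelfAdjoint.one _).sub hB.isSelfAdjoint, ?_, fun a => ?_⟩,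
    fun S hS => ?_⟩
  · rw [← norm_neg, neg_sub]
    exact norm_sub_one_le_one hB2
  · rw [happ, hBj']
    module
  · obtain ⟨hSs, hSn, hSA⟩ := (mem_contractiveExtensions_cayley_iff hsymm hnonneg).1 hS
    have h := hmin (1 + -S) (isPositive_one_add hSs.neg (by rwa [norm_neg])) fun a => by
      change (a + A a) + -S (a + A a) = (2 : ℂ) • A a
      rw [hSA]
      module
    rw [ContinuousLinearMap.le_def] at h ⊢
    convert h using 1
    abel

theorem isLeast_Tμ (hsymm : A.IsFormalAdjoint A)
    (hnonneg : ∀ x : A.domain, 0 ≤ (⟪A x, x⟫_ℂ).re) :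
    IsLeast (contractiveExtensions (cayley A)) (Tμ A) :=
  Classical.epsilon_spec ((exists_isLeast_contractiveExtensions hsymm hnonneg).imp fun _ h => h.1)

theorem isGreatest_TM (hsymm : A.IsFormalAdjoint A)
    (hnonneg : ∀ x : A.domain, 0 ≤ (⟪A x, x⟫_ℂ).re) :
    IsGreatest (contractiveExtensions (cayley A)) (TM A) :=
  Classical.epsilon_spec (exists_isGreatest_contractiveExtensions hsymm hnonneg)

/-- The range of `E + T_μ` meets the orthogonal complement of `(E + A) D(A)` only in `0`. -/
theorem add_Tμ_apply_eq_zero (hsymm : A.IsFormalAdjoint A)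
    (hnonneg : ∀ x : A.domain, 0 ≤ (⟪A x, x⟫_ℂ).re) {u : H}
    (hu : ∀ a : A.domain, ⟪u + Tμ A u, a + A a⟫_ℂ = 0) : u + Tμ A u = 0 := by
  obtain ⟨S, hS, h⟩ := exists_isLeast_contractiveExtensions hsymm hnonneg
  rw [(isLeast_Tμ hsymm hnonneg).unique hS] at hu ⊢
  exact h u hu

end Nonneg

/-! ### Self-adjoint extensions of the operator -/

theorem mem_graph_adjoint_iff {A : H →ₗ.[ℂ] H} (hdense : Dense (A.domain : Set H)) {v w : H} :
    (v, w) ∈ A.adjoint.graph ↔ ∀ a : A.domain, ⟪w, a⟫_ℂ = ⟪v, A a⟫_ℂ := by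
  rw [LinearPMap.adjoint_graph_eq_graph_adjoint hdense, Submodule.mem_adjoint_iff]
  constructor
  · intro h a
    have := sub_eq_zero.1 (h a (A a) (LinearPMap.mem_graph A a))
    rw [← inner_conj_symm, ← this, inner_conj_symm]
  · intro h a b hab
    obtain ⟨x, rfl, rfl⟩ := (LinearPMap.mem_graph_iff _).1 hab
    rw [sub_eq_zero, ← inner_conj_symm, ← h x, inner_conj_symm]

/-- The deficiency space `N_{-1}` is the orthogonal complement of `(E + A) D(A)`. -/
theorem mem_defectSubspace_neg_one_iff {A : H →ₗ.[ℂ] H} (hdense : Dense (A.domain : Set H))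
    {x : H} : x ∈ defectSubspace A (-1) ↔ ∀ a : A.domain, ⟪x, a + A a⟫_ℂ = 0 := by
  change (x, (-1 : ℂ) • x) ∈ A.adjoint.graph ↔ _
  rw [mem_graph_adjoint_iff hdense]
  refine forall_congr' fun a => ?_
  rw [neg_one_smul, inner_neg_left, inner_add_right, neg_eq_iff_add_eq_zero]

section Extension

variable {A : H →ₗ.[ℂ] H} {S : H →L[ℂ] H}

theorem inner_add_apply_left (hS : IsSelfAdjoint S) (x y : H) :
    ⟪x + S x, y⟫_ℂ = ⟪x, y + S y⟫_ℂ := by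
  rw [inner_add_left, inner_add_right]
  exact congrArg _ (hS.isSymmetric x y)

theorem inner_sub_apply_left (hS : IsSelfAdjoint S) (x y : H) :
    ⟪x - S x, y⟫_ℂ = ⟪x, y - S y⟫_ℂ := by
  rw [inner_sub_left, inner_sub_right]
  exact congrArg _ (hS.isSymmetric x y)

/-- `E + S` is injective, since its range contains `D(A)`. -/
theorem eq_zero_of_add_extension_eq_zero (hdense : Dense (A.domain : Set H))
    (hS : IsSelfAdjoint S) (hSA : ∀ a : A.domain, S (a + A a) = a - A a) {y : H}
    (hy : y + S y = 0) : y = 0 := by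
  refine hdense.eq_zero_of_inner_left ℂ fun a ha => ?_
  have h : (2 : ℂ) • a = (a + A ⟨a, ha⟩) + S (a + A ⟨a, ha⟩) := by
    rw [hSA ⟨a, ha⟩]
    module
  have h2 : ⟪y, (2 : ℂ) • a⟫_ℂ = 0 := by
    rw [h, ← inner_add_apply_left hS, hy, inner_zero_left]
  simpa [inner_smul_right] using h2

theorem mem_graph_cayley_everywhere_iff (hdense : Dense (A.domain : Set H))
    (hS : IsSelfAdjoint S) (hSA : ∀ a : A.domain, S (a + A a) = a - A a) {p q : H} :
    (p, q) ∈ (cayley (everywhere S)).graph ↔ ∃ y, p = y + S y ∧ q = y - S y := by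
  rw [mem_graph_cayley_iff]
  · exact ⟨fun ⟨a, h⟩ => ⟨a, h⟩, fun ⟨y, h⟩ => ⟨⟨y, trivial⟩, h⟩⟩
  · exact fun a ha => Subtype.ext (eq_zero_of_add_extension_eq_zero hdense hS hSA ha)

theorem mem_domain_cayley_everywhere_iff (hdense : Dense (A.domain : Set H))
    (hS : IsSelfAdjoint S) (hSA : ∀ a : A.domain, S (a + A a) = a - A a) {p : H} :
    p ∈ (cayley (everywhere S)).domain ↔ ∃ y, p = y + S y := by
  rw [LinearPMap.mem_domain_iff]
  simp only [mem_graph_cayley_everywhere_iff hdense hS hSA]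
  exact ⟨fun ⟨_, y, h, _⟩ => ⟨y, h⟩, fun ⟨y, h⟩ => ⟨_, y, h, rfl⟩⟩

/-- The pair `(a, A a)` is `(y + S y, y - S y)` for `y = (a + A a) / 2`. -/
theorem le_cayley_everywhere (hdense : Dense (A.domain : Set H))
    (hS : IsSelfAdjoint S) (hSA : ∀ a : A.domain, S (a + A a) = a - A a) :
    A ≤ cayley (everywhere S) := by
  rw [← LinearPMap.le_graph_iff]
  rintro ⟨p, q⟩ hpq
  obtain ⟨a, rfl, rfl⟩ := (LinearPMap.mem_graph_iff _).1 hpq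
  refine (mem_graph_cayley_everywhere_iff hdense hS hSA).2 ⟨(2⁻¹ : ℂ) • (a + A a), ?_, ?_⟩ <;>
  · simp only [map_smul, hSA]
    module

/-- The operator with graph `{(y + S y, y - S y)}` is self-adjoint: `(v, w)` lies in the graph of its
adjoint iff `w + S w = v - S v`, and then `y = (v + w) / 2` exhibits it in the graph. -/
theorem adjoint_cayley_everywhere (hdense : Dense (A.domain : Set H))
    (hS : IsSelfAdjoint S) (hSA : ∀ a : A.domain, S (a + A a) = a - A a) :
    (cayley (everywhere S)).adjoint = cayley (everywhere S) := by
  have hd : Dense ((cayley (everywhere S)).domain : Set H) :=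
    hdense.mono (le_cayley_everywhere hdense hS hSA).1
  refine LinearPMap.eq_of_eq_graph (Submodule.ext fun ⟨v, w⟩ => ?_)
  rw [mem_graph_adjoint_iff hd, mem_graph_cayley_everywhere_iff hdense hS hSA]
  constructor
  · intro h
    have h1 : w + S w = v - S v := by
      refine ext_inner_right ℂ fun y => ?_
      obtain ⟨x, hx, hx'⟩ := (LinearPMap.mem_graph_iff _).1
        ((mem_graph_cayley_everywhere_iff hdense hS hSA).2 ⟨y, rfl, rfl⟩)
      simp only at hx hx'
      rw [inner_add_apply_left hS, inner_sub_apply_left hS, ← hx, ← hx', h x]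
    have h2 : S v = v - w - S w := by rw [sub_sub, h1]; abel
    refine ⟨(2⁻¹ : ℂ) • (v + w), ?_, ?_⟩ <;>
    · simp only [map_smul, map_add, h2]
      module
  · rintro ⟨y, rfl, rfl⟩ x
    obtain ⟨z, hz, hz'⟩ := (mem_graph_cayley_everywhere_iff hdense hS hSA).1
      (LinearPMap.mem_graph _ x)
    rw [hz, hz', inner_sub_apply_left hS, inner_add_apply_left hS]
    simp only [map_add, map_sub]
    congr 1
    abel

theorem isProperExtension_cayley_everywhere (hdense : Dense (A.domain : Set H))
    (hS : IsSelfAdjoint S) (hSA : ∀ a : A.domain, S (a + A a) = a - A a) :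
    IsProperExtension A (cayley (everywhere S)) := by
  have hle := le_cayley_everywhere hdense hS hSA
  have hadj := adjoint_cayley_everywhere hdense hS hSA
  refine ⟨hle, ?_, by rw [hadj, hadj]⟩
  rw [← LinearPMap.le_graph_iff]
  rintro ⟨v, w⟩ h
  rw [← hadj, mem_graph_adjoint_iff (hdense.mono hle.1)] at h
  refine (mem_graph_adjoint_iff hdense).2 fun a => ?_
  rw [hle.2 (x := a) (y := ⟨a, hle.1 a.2⟩) rfl]
  exact h ⟨a, hle.1 a.2⟩

/-- `D(A*) = D(Ã) + N_{-1}` for the extension `Ã` that corresponds to `S`: a pair `(v, w)` in the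
graph of `A*` gives `v = (E + S) y + n` with `y = (v + w) / 2` and `n ∈ N_{-1}`. -/
theorem exists_add_mem_defectSubspace (hdense : Dense (A.domain : Set H))
    (hS : IsSelfAdjoint S) (hSA : ∀ a : A.domain, S (a + A a) = a - A a) {v : H}
    (hv : v ∈ A.adjoint.domain) :
    ∃ y, ∃ n ∈ defectSubspace A (-1), v = (y + S y) + n := by
  obtain ⟨w, hw⟩ := LinearPMap.mem_domain_iff.1 hv
  rw [mem_graph_adjoint_iff hdense] at hw
  let y : H := (2⁻¹ : ℂ) • (v + w)
  refine ⟨y, v - (y + S y), (mem_defectSubspace_neg_one_iff hdense).2 fun a => ?_, by abel⟩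
  have h : (a + A a) + S (a + A a) = (2 : ℂ) • (a : H) := by
    rw [hSA]
    module
  rw [inner_sub_left, inner_add_apply_left hS, h, inner_smul_left, inner_smul_right,
    inner_add_left, inner_add_right, hw a, map_inv₀, map_ofNat]
  ring

/-- `N_{-1}` embeds into `N_i` by `x ↦ (E - i S)⁻¹ x`. -/
theorem finiteDimensional_defectSubspace_neg_one (hdense : Dense (A.domain : Set H))
    (hS : IsSelfAdjoint S) (hSA : ∀ a : A.domain, S (a + A a) = a - A a)
    (hfin : FiniteDimensional ℂ (defectSubspace A Complex.I)) :
    FiniteDimensional ℂ (defectSubspace A (-1)) := by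
  -- The spectrum of `S` is real, and `E - i S = i (-i E - S)`.
  have hunit : IsUnit (1 - Complex.I • S) := by
    have h : IsUnit (algebraMap ℂ (H →L[ℂ] H) (-Complex.I) - S) := by
      by_contra h
      have := hS.im_eq_zero_of_mem_spectrum h
      simp at this
    have h2 : 1 - Complex.I • S =
        Complex.I • (algebraMap ℂ (H →L[ℂ] H) (-Complex.I) - S) := by
      rw [smul_sub, Algebra.algebraMap_eq_smul_one, smul_smul]
      simp
    rw [h2]
    exact h.smul (Units.mk0 Complex.I Complex.I_ne_zero)
  obtain ⟨U, hU⟩ := hunit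
  let R : H →L[ℂ] H := ↑U⁻¹
  have hR : ∀ x, R x - Complex.I • S (R x) = x := fun x => by
    have : ((U : H →L[ℂ] H) * R) x = x := by simp [R]
    rwa [hU] at this
  -- If `r - i S r` is orthogonal to `(E + A) D(A)`, then `⟪i r, a⟫ = ⟪r, A a⟫`.
  have hmem : ∀ x ∈ defectSubspace A (-1), R x ∈ defectSubspace A Complex.I := fun x hx => by
    rw [mem_defectSubspace_neg_one_iff hdense] at hx
    change (R x, Complex.I • R x) ∈ A.adjoint.graph
    refine (mem_graph_adjoint_iff hdense).2 fun a => ?_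
    have h := hx a
    rw [← hR x, inner_sub_left, inner_smul_left,
      show ⟪S (R x), a + A a⟫_ℂ = ⟪R x, S (a + A a)⟫_ℂ from hS.isSymmetric _ _, hSA,
      inner_add_right, inner_sub_right, Complex.conj_I] at h
    rw [inner_smul_left, Complex.conj_I]
    linear_combination (-(1 + Complex.I) / 2) * h +
      ((⟪R x, a⟫_ℂ - ⟪R x, A a⟫_ℂ) / 2) * Complex.I_sq
  let f : defectSubspace A (-1) →ₗ[ℂ] defectSubspace A Complex.I :=
    (R : H →ₗ[ℂ] H).restrict hmem
  refine FiniteDimensional.of_injective f fun x y hxy => Subtype.ext ?_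
  have h : R x = R y := congrArg Subtype.val hxy
  rw [← hR x, h, hR]

end Extension

/-- `(E + A) D(A)` is closed: `E + A` is bounded below on the graph of `A`, which is complete. -/
theorem isClosed_range_idAdd {A : H →ₗ.[ℂ] H} (hclosed : A.IsClosed)
    (hsymm : A.IsFormalAdjoint A) (hnonneg : ∀ x : A.domain, 0 ≤ (⟪A x, x⟫_ℂ).re) :
    IsClosed (LinearMap.range (idAdd A) : Set H) := by
  have : CompleteSpace A.graph := hclosed.completeSpace_coe
  let f : A.graph →L[ℂ] H :=
    (ContinuousLinearMap.fst ℂ H H + ContinuousLinearMap.snd ℂ H H) ∘L A.graph.subtypeL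
  have hf : AntilipschitzWith 1 f := by
    refine f.antilipschitz_of_bound fun ⟨⟨p, q⟩, hpq⟩ => ?_
    obtain ⟨a, rfl, rfl⟩ := (LinearPMap.mem_graph_iff _).1 hpq
    have h := norm_add_apply_sq hsymm a
    have h0 := hnonneg a
    rw [NNReal.coe_one, one_mul]
    change max ‖(a : H)‖ ‖A a‖ ≤ ‖(a : H) + A a‖
    refine max_le ?_ ?_ <;> refine abs_le_of_sq_le_sq' ?_ (norm_nonneg _) |>.2 <;>
      nlinarith [sq_nonneg ‖A a‖, sq_nonneg ‖(a : H)‖]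
  have hr : (LinearMap.range (idAdd A) : Set H) = Set.range f := by
    ext x
    constructor
    · rintro ⟨a, rfl⟩
      exact ⟨⟨_, LinearPMap.mem_graph A a⟩, rfl⟩
    · rintro ⟨⟨⟨p, q⟩, hpq⟩, rfl⟩
      obtain ⟨a, rfl, rfl⟩ := (LinearPMap.mem_graph_iff _).1 hpq
      exact ⟨a, rfl⟩
  rw [hr]
  exact hf.isClosed_range f.uniformContinuous

end NonnegExtension

open NonnegExtension in
theorem proposition3p2 {H : Type*} [NormedAddCommGroup H] [InnerProductSpace ℂ H] [CompleteSpace H]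
    (A : H →ₗ.[ℂ] H)
    (hdense : Dense (A.domain : Set H))
    (hclosed : A.IsClosed)
    (hsymm : A.IsFormalAdjoint A)
    (hnonneg : ∀ x : A.domain, 0 ≤ (inner ℂ (A x) (x : H)).re)
    (hdefect : NonnegExtension.FiniteDefectNumbers A)
    (hindet : NonnegExtension.CompletelyIndeterminate A) :
    NonnegExtension.Transversal A (NonnegExtension.Aμ A) (NonnegExtension.AM A) := by
  obtain ⟨hm, -, hmA⟩ := (mem_contractiveExtensions_cayley_iff hsymm hnonneg).1
    (isLeast_Tμ hsymm hnonneg).1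
  obtain ⟨hM, -, hMA⟩ := (mem_contractiveExtensions_cayley_iff hsymm hnonneg).1
    (isGreatest_TM hsymm hnonneg).1
  have hpm : IsProperExtension A (Aμ A) := isProperExtension_cayley_everywhere hdense hm hmA
  have hpM : IsProperExtension A (AM A) := isProperExtension_cayley_everywhere hdense hM hMA
  have hdm : ∀ {p : H}, p ∈ (Aμ A).domain ↔ ∃ y, p = y + Tμ A y :=
    mem_domain_cayley_everywhere_iff hdense hm hmA
  have hdM : ∀ {p : H}, p ∈ (AM A).domain ↔ ∃ y, p = y + TM A y :=
    mem_domain_cayley_everywhere_iff hdense hM hMA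
  -- `C = T_M - T_μ` is symmetric and vanishes on `(E + A) D(A)`, so it maps into `N_{-1}`.
  have hCmem : ∀ x, TM A x - Tμ A x ∈ defectSubspace A (-1) := fun x => by
    refine (mem_defectSubspace_neg_one_iff hdense).2 fun a => ?_
    rw [inner_sub_left, show ⟪TM A x, a + A a⟫_ℂ = ⟪x, TM A (a + A a)⟫_ℂ from hM.isSymmetric _ _,
      show ⟪Tμ A x, a + A a⟫_ℂ = ⟪x, Tμ A (a + A a)⟫_ℂ from hm.isSymmetric _ _, hMA, hmA, sub_self]
  have hCker : ∀ n ∈ defectSubspace A (-1), TM A n - Tμ A n = 0 → n = 0 := fun n hn h =>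
    congrArg Subtype.val ((LinearMap.ker_eq_bot'.1 hindet) ⟨n, hn⟩ h)
  refine ⟨hpm, hpM, le_antisymm ?_ (le_inf hpm.1.1 hpM.1.1),
    le_antisymm (sup_le hpm.2.1.1 hpM.2.1.1) ?_⟩
  · rintro p ⟨h1, h2⟩
    obtain ⟨y, hy⟩ := hdm.1 h1
    obtain ⟨z, hz⟩ := hdM.1 h2
    -- `(E + T_μ) (y - z) = C z` lies in `N_{-1}`, hence vanishes.
    have hyz : (y - z) + Tμ A (y - z) = TM A z - Tμ A z := by
      rw [map_sub, show y - z + (Tμ A y - Tμ A z) = (y + Tμ A y) - (z + Tμ A z) by abel, ← hy, hz]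
      abel
    have hC : TM A z - Tμ A z = 0 := by
      rw [← hyz]
      refine add_Tμ_apply_eq_zero hsymm hnonneg ?_
      rw [hyz]
      exact (mem_defectSubspace_neg_one_iff hdense).1 (hCmem z)
    -- The component of `z` in `N_{-1}` is in the kernel of `C`, so `z` is in `(E + A) D(A)`.
    let K := LinearMap.range (idAdd A)
    have : CompleteSpace K :=
      (isClosed_range_idAdd hclosed hsymm hnonneg).completeSpace_coe
    obtain ⟨k, ⟨a, rfl⟩, n, hn, rfl⟩ := K.exists_add_mem_mem_orthogonal z
    have hnN : n ∈ defectSubspace A (-1) := (mem_defectSubspace_neg_one_iff hdense).2 fun b =>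
      (Submodule.mem_orthogonal' _ _).1 hn _ ⟨b, rfl⟩
    have hn0 : n = 0 := hCker n hnN <| by
      rw [← hC, map_add, map_add, idAdd_apply, hMA, hmA]
      abel
    rw [hn0, add_zero, idAdd_apply, hMA] at hz
    have h : p = (2 : ℂ) • (a : H) := by
      rw [hz]
      module
    rw [h]
    exact A.domain.smul_mem _ a.2
  · intro v hv
    obtain ⟨y, n, hn, rfl⟩ := exists_add_mem_defectSubspace hdense hm hmA hv
    -- An injective endomorphism of the finite-dimensional space `N_{-1}` is surjective.
    have := finiteDimensional_defectSubspace_neg_one hdense hm hmA hdefect.1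
    let C : defectSubspace A (-1) →ₗ[ℂ] defectSubspace A (-1) :=
      ((TM A - Tμ A : H →L[ℂ] H) : H →ₗ[ℂ] H).restrict fun x _ => hCmem x
    have hC : Function.Injective C := (injective_iff_map_eq_zero C).2 fun x hx =>
      Subtype.ext (hCker x x.2 (congrArg Subtype.val hx))
    obtain ⟨x, hx⟩ := LinearMap.injective_iff_surjective.1 hC ⟨n, hn⟩
    have hx' : TM A x - Tμ A x = n := congrArg Subtype.val hx
    refine Submodule.mem_sup.2 ⟨_, hdm.2 ⟨y - x, rfl⟩, _, hdM.2 ⟨x, rfl⟩, ?_⟩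
    rw [map_sub, ← hx']
    abel
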